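/- Let $\mathbb H=\mathbb R^2\times\mathbb R$ be the Heisenberg group with law $(x,t)*(x',t')=(x+x',\,t+t'+2(x_2x_1'-x_1x_2'))$ and the left-invariant Korányi metric $d_{\mathbb H}(p,q)=\|p^{-1}*q\|$, $\|(x,t)\|=(|x|^4+t^2)^{1/4}$. Let $X_1,X_2$ be the left-invariant vector fields on $\mathbb H$ that equal $\partial_{x_1},\partial_{x_2}$ at the identity, and let $d_{cc}$ be the Carnot–Carathéodory (CC) metric on $\mathbb H$, that is, the infimum of the lengths of smooth curves tangent to $\operatorname{span}\{X_1,X_2\}$ joining two points, where lengths are measured by declaring $X_1,X_2$ orthonormal. Let $G$ be the Grushin plane, i.e. $\mathbb R^2$ with the CC metric $$d_{cc}((u_1,v_1),(u_2,v_2))=\inf_\gamma\int_a^b\sqrt{u'(s)^2+\frac{v'(s)^2}{u(s)^2}}\,ds,$$ where the infimum is over all smooth curves $\gamma=(u,v):[a,b]\to\mathbb R^2$ joining the two points such that $v'(s)=0$ whenever $u(s)=0$ (at such $s$ the quotient is read as $0$). For $\sigma\ge 0$, a triple $(X,W,\pi)$ is a $\sigma$-foliation if $\pi:X\to W$ is a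 surjection between proper metric spaces such that for every compact $K\subseteq X$ the restriction $\pi|_K$ is Lipschitz, and there are $C\ge1$ and $r_0>0$ such that for every ball $B\subseteq W$ of radius $r<r_0$ the set $\pi^{-1}(B)\cap K$ can be covered by at most $Cr^{-\sigma}$ balls in $X$ of radius $Cr$. **Proposition.** Let $\mathbb V=\ell\times\{0\}\subset\mathbb H$ be a horizontal line, where $\ell\subset\mathbb R^2$ is a line through the origin, and let $\mathcal X=\{\mathbb V*a: a\in\mathbb H\}$ be the space of right cosets of $\mathbb V$ with the distance $\operatorname{dist}_{cc}(A,A')=\inf\{d_{cc}(p,q):p\in A,\ q\in A'\}$. Then $\mathcal X$ can be identified with $G$ by an isometric bijection; and for every isometric bijection $\Phi:\mathcal X\to G$, the projection $\pi^R:(\mathbb H,d_{\mathbb H})\to G$, $\pi^R(p)=\Phi(\mathbb V*p)$, is Lipschitz, and $(\mathbb H,G,\pi^R)$ is a $2$-foliation: $\mathbb H$ and $G$ are proper metric spaces, $\pi^R$ is surjective and Lipschitz, and for every compact $K\subset\mathbb H$ there are $C\ge1$ and $r_0>0$ such that for every ball $B\subset G$ of radius $r<r_0$ the set $(\pi^R)^{-1}(B)\cap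 K$ can be covered by at most $Cr^{-2}$ Korányi balls of radius $Cr$. -/

import Mathlib

open scoped ContDiff ENNReal

/-! ### Metric foliations -/

/-- `π : X → W` is locally David–Semmes `s`-regular, i.e. `(X, W, π)` is an `s`-foliation: a
surjection between proper metric spaces such that for every compact `K ⊆ X` the restriction of `π`
to `K` is Lipschitz, and there are `C ≥ 1`, `r₀ > 0` such that for every ball `B ⊆ W` of radius
`r < r₀` the set `π ⁻¹(B) ∩ K` is covered by at most `C r ^ (-s)` balls in `X` of radius `C r`. -/
structure IsMetricFoliation {X W : Type*} [MetricSpace X] [MetricSpace W] (s : ℝ) (π : X → W) :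
    Prop where
  exponent_nonneg : 0 ≤ s
  properSpace_dom : ProperSpace X
  properSpace_cod : ProperSpace W
  surjective : Function.Surjective π
  lipschitzOn_compact : ∀ K : Set X, IsCompact K → ∃ L : NNReal, LipschitzOnWith L π K
  covering : ∀ K : Set X, IsCompact K → ∃ C : ℝ, 1 ≤ C ∧ ∃ r₀ : ℝ, 0 < r₀ ∧
    ∀ (w : W) (r : ℝ), 0 < r → r < r₀ →
      ∃ T : Finset X, (T.card : ℝ) ≤ C * r ^ (-s) ∧
        π ⁻¹' Metric.ball w r ∩ K ⊆ ⋃ x ∈ T, Metric.ball x (C * r)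

/-! ### The Heisenberg group with the Korányi metric -/

/-- The first Heisenberg group; points are `(x, t)` with `x = (x1, x2) ∈ ℝ²` and `t ∈ ℝ`. -/
@[ext] structure Heis where
  x1 : ℝ
  x2 : ℝ
  t : ℝ

namespace Heis

/-- `(x, t) * (x', t') = (x + x', t + t' + 2 ω(x, x'))`, `ω(x, x') = x₂ x₁' - x₁ x₂'`. -/
instance : Mul Heis :=
  ⟨fun p q => ⟨p.x1 + q.x1, p.x2 + q.x2, p.t + q.t + 2 * (p.x2 * q.x1 - p.x1 * q.x2)⟩⟩

instance : One Heis := ⟨⟨0, 0, 0⟩⟩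

instance : Inv Heis := ⟨fun p => ⟨-p.x1, -p.x2, -p.t⟩⟩

@[simp] theorem mul_x1 (p q : Heis) : (p * q).x1 = p.x1 + q.x1 := rfl
@[simp] theorem mul_x2 (p q : Heis) : (p * q).x2 = p.x2 + q.x2 := rfl
@[simp] theorem mul_t (p q : Heis) :
    (p * q).t = p.t + q.t + 2 * (p.x2 * q.x1 - p.x1 * q.x2) := rfl
@[simp] theorem one_x1 : (1 : Heis).x1 = 0 := rfl
@[simp] theorem one_x2 : (1 : Heis).x2 = 0 := rfl
@[simp] theorem one_t : (1 : Heis).t = 0 := rfl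
@[simp] theorem inv_x1 (p : Heis) : (p⁻¹).x1 = -p.x1 := rfl
@[simp] theorem inv_x2 (p : Heis) : (p⁻¹).x2 = -p.x2 := rfl
@[simp] theorem inv_t (p : Heis) : (p⁻¹).t = -p.t := rfl

instance : Group Heis :=
  Group.ofLeftAxioms
    (fun p q r => by ext <;> simp <;> ring)
    (fun p => by ext <;> simp)
    (fun p => by
      ext
      · simp
      · simp
      · simp only [mul_t, inv_x1, inv_x2, inv_t, one_t]; ring)

/-- The Korányi norm `‖(x, t)‖ = (|x|⁴ + t²) ^ (1 / 4)`. -/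
noncomputable def koranyiNorm (p : Heis) : ℝ :=
  ((p.x1 ^ 2 + p.x2 ^ 2) ^ 2 + p.t ^ 2) ^ (1 / 4 : ℝ)

theorem koranyiNorm_nonneg (p : Heis) : 0 ≤ p.koranyiNorm :=
  Real.rpow_nonneg (by positivity) _

theorem koranyiNorm_sq (p : Heis) :
    p.koranyiNorm ^ 2 = ‖(⟨p.x1 ^ 2 + p.x2 ^ 2, p.t⟩ : ℂ)‖ := by
  rw [koranyiNorm, ← Real.rpow_natCast, ← Real.rpow_mul (by positivity), Complex.norm_def,
    Complex.normSq_mk, Real.sqrt_eq_rpow]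
  congr 1
  · ring
  · norm_num

theorem koranyiNorm_inv (p : Heis) : (p⁻¹).koranyiNorm = p.koranyiNorm := by
  simp [koranyiNorm]

theorem koranyiNorm_eq_zero {p : Heis} (h : p.koranyiNorm = 0) : p = 1 := by
  have h2 := koranyiNorm_sq p
  rw [h, zero_pow two_ne_zero, eq_comm, norm_eq_zero, Complex.ext_iff] at h2
  simp only [Complex.zero_re, Complex.zero_im] at h2
  obtain ⟨h2, h3⟩ := h2
  ext
  · simpa using (by nlinarith [sq_nonneg p.x1, sq_nonneg p.x2] : p.x1 ^ 2 = 0)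
  · simpa using (by nlinarith [sq_nonneg p.x1, sq_nonneg p.x2] : p.x2 ^ 2 = 0)
  · exact h3

theorem koranyiNorm_mul_le (p q : Heis) :
    (p * q).koranyiNorm ≤ p.koranyiNorm + q.koranyiNorm := by
  have key : ∀ p : Heis, ‖(⟨p.x1, p.x2⟩ : ℂ)‖ ≤ p.koranyiNorm := by
    intro p
    refine le_of_sq_le_sq ?_ (koranyiNorm_nonneg p)
    rw [koranyiNorm_sq, Complex.sq_norm, Complex.normSq_mk]
    refine le_trans ?_ (Complex.abs_re_le_norm _)
    refine le_trans (le_of_eq ?_) (le_abs_self _)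
    ring
  refine le_of_sq_le_sq ?_ (add_nonneg (koranyiNorm_nonneg p) (koranyiNorm_nonneg q))
  have h : (⟨(p * q).x1 ^ 2 + (p * q).x2 ^ 2, (p * q).t⟩ : ℂ)
      = ⟨p.x1 ^ 2 + p.x2 ^ 2, p.t⟩ + ⟨q.x1 ^ 2 + q.x2 ^ 2, q.t⟩
        + 2 * (⟨p.x1, p.x2⟩ * (starRingEnd ℂ) ⟨q.x1, q.x2⟩) := by
    apply Complex.ext <;> simp <;> ring
  rw [koranyiNorm_sq, h]
  refine (norm_add_le _ _).trans ?_
  refine (add_le_add_left (norm_add_le _ _) _).trans ?_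
  rw [← koranyiNorm_sq, ← koranyiNorm_sq, norm_mul, norm_mul, Complex.norm_conj]
  have h1 := mul_le_mul (key p) (key q) (norm_nonneg _) (koranyiNorm_nonneg p)
  simp only [Complex.norm_ofNat]
  nlinarith

/-- The left-invariant Korányi metric `d(p, q) = ‖p⁻¹ * q‖`. -/
noncomputable instance : MetricSpace Heis where
  dist p q := (p⁻¹ * q).koranyiNorm
  dist_self p := by
    simp [koranyiNorm]
  dist_comm p q := by
    rw [← koranyiNorm_inv (p⁻¹ * q)]
    simp
  dist_triangle p q r := by
    have := koranyiNorm_mul_le (p⁻¹ * q) (q⁻¹ * r)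
    simpa [mul_assoc] using this
  eq_of_dist_eq_zero h := by
    have := koranyiNorm_eq_zero h
    exact (inv_mul_eq_one.mp this)

/-! ### The Carnot–Carathéodory distance of the Heisenberg group and right cosets -/

/-- The left-invariant vector field with value `∂/∂x₁` at the identity. -/
def X1 (p : Heis) : ℝ × ℝ × ℝ := (1, 0, 2 * p.x2)

/-- The left-invariant vector field with value `∂/∂x₂` at the identity. -/
def X2 (p : Heis) : ℝ × ℝ × ℝ := (0, 1, -2 * p.x1)

/-- A smooth horizontal curve `s ↦ (x1 s, x2 s, t s)`, `s ∈ [a, b]`, from `p` to `q`: its velocity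
lies in the span of `X1` and `X2` at every point. -/
structure HorizontalCurve (p q : Heis) where
  a : ℝ
  b : ℝ
  le : a ≤ b
  x1 : ℝ → ℝ
  x2 : ℝ → ℝ
  t : ℝ → ℝ
  contDiff_x1 : ContDiff ℝ ∞ x1
  contDiff_x2 : ContDiff ℝ ∞ x2
  contDiff_t : ContDiff ℝ ∞ t
  horizontal : ∀ s ∈ Set.Icc a b, (deriv x1 s, deriv x2 s, deriv t s) ∈
    Submodule.span ℝ {X1 ⟨x1 s, x2 s, t s⟩, X2 ⟨x1 s, x2 s, t s⟩}
  source : (⟨x1 a, x2 a, t a⟩ : Heis) = p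
  target : (⟨x1 b, x2 b, t b⟩ : Heis) = q

/-- The length of a horizontal curve when `X1`, `X2` are orthonormal; a horizontal velocity
`γ' = α X1 + β X2` has the coefficients `α = x1'` and `β = x2'`. -/
noncomputable def HorizontalCurve.length {p q : Heis} (γ : HorizontalCurve p q) : ℝ≥0∞ :=
  ∫⁻ s in Set.Icc γ.a γ.b, ENNReal.ofReal (√((deriv γ.x1 s) ^ 2 + (deriv γ.x2 s) ^ 2))

/-- The Carnot–Carathéodory distance of the Heisenberg group. -/
noncomputable def ccEDist (p q : Heis) : ℝ≥0∞ := ⨅ γ : HorizontalCurve p q, γ.length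

/-- `V` is a horizontal line: `V = ℓ × {0}` for a line `ℓ ⊆ ℝ²` through the origin. -/
def IsHorizontalLine (V : Subgroup Heis) : Prop :=
  ∃ a b : ℝ, (a, b) ≠ (0, 0) ∧ (V : Set Heis) = {p | ∃ s : ℝ, p = ⟨s * a, s * b, 0⟩}

/-- The space of right cosets `V * a` of `V`. -/
abbrev RightCosets (V : Subgroup Heis) : Type := Quotient (QuotientGroup.rightRel V)

/-- The quotient map sending `p` to the right coset `V * p`. -/
def toRightCoset (V : Subgroup Heis) (p : Heis) : RightCosets V :=
  Quotient.mk (QuotientGroup.rightRel V) p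

/-- `dist_cc(A, B)`, the infimum of the Carnot–Carathéodory distances of points of the right cosets
`A` and `B`. -/
noncomputable def cosetCCEDist (V : Subgroup Heis) (A B : RightCosets V) : ℝ≥0∞ :=
  ⨅ (p : Heis) (_ : toRightCoset V p = A) (q : Heis) (_ : toRightCoset V q = B), ccEDist p q

end Heis

/-! ### The Grushin plane -/

/-- The Grushin plane; points are `(u, v) ∈ ℝ²`. -/
@[ext] structure GrushinPlane where
  u : ℝ
  v : ℝ

namespace GrushinPlane

/-- A smooth horizontal curve `s ↦ (u s, v s)`, `s ∈ [a, b]`, from `p` to `q`: `v'` vanishes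
wherever `u` does. -/
structure HorizontalCurve (p q : GrushinPlane) where
  a : ℝ
  b : ℝ
  le : a ≤ b
  u : ℝ → ℝ
  v : ℝ → ℝ
  contDiff_u : ContDiff ℝ ∞ u
  contDiff_v : ContDiff ℝ ∞ v
  horizontal : ∀ s ∈ Set.Icc a b, u s = 0 → deriv v s = 0
  source : (⟨u a, v a⟩ : GrushinPlane) = p
  target : (⟨u b, v b⟩ : GrushinPlane) = q

/-- The speed `√(u'² + v'² / u²)` in the Grushin plane. Where `u = 0` (and so `v' = 0`) the second
summand is `0`. -/
noncomputable def speed (u v : ℝ → ℝ) (s : ℝ) : ℝ≥0∞ :=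
  ENNReal.ofReal (√((deriv u s) ^ 2 + (deriv v s) ^ 2 / (u s) ^ 2))

/-- The length of a horizontal curve in the Grushin plane; it may be infinite. -/
noncomputable def HorizontalCurve.length {p q : GrushinPlane} (γ : HorizontalCurve p q) : ℝ≥0∞ :=
  ∫⁻ s in Set.Icc γ.a γ.b, speed γ.u γ.v s

/-- The Carnot–Carathéodory distance of the Grushin plane. -/
noncomputable def ccEDist (p q : GrushinPlane) : ℝ≥0∞ := ⨅ γ : HorizontalCurve p q, γ.length

theorem ccEDist_self (p : GrushinPlane) : ccEDist p p = 0 := by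
  let γ : HorizontalCurve p p :=
    { a := 0, b := 0, le := le_rfl, u := fun _ => p.u, v := fun _ => p.v
      contDiff_u := contDiff_const, contDiff_v := contDiff_const
      horizontal := by simp
      source := rfl, target := rfl }
  refine le_antisymm ((iInf_le _ γ).trans (le_of_eq ?_)) zero_le
  exact MeasureTheory.setLIntegral_measure_zero _ _ (by simp [γ])

theorem ccEDist_le_symm (p q : GrushinPlane) : ccEDist p q ≤ ccEDist q p := by
  refine le_iInf fun γ => ?_
  let γ' : HorizontalCurve p q :=
    { a := -γ.b, b := -γ.a, le := neg_le_neg γ.le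
      u := fun s => γ.u (-s), v := fun s => γ.v (-s)
      contDiff_u := γ.contDiff_u.comp contDiff_neg
      contDiff_v := γ.contDiff_v.comp contDiff_neg
      horizontal := by
        intro s hs h
        rw [deriv_comp_neg, γ.horizontal (-s) ⟨by linarith [hs.2], by linarith [hs.1]⟩ h, neg_zero]
      source := by simpa using γ.target
      target := by simpa using γ.source }
  refine (iInf_le _ γ').trans (le_of_eq ?_)
  have h := (MeasureTheory.Measure.measurePreserving_neg
    (MeasureTheory.volume : MeasureTheory.Measure ℝ)).setLIntegral_comp_preimage_emb
    (Homeomorph.neg ℝ).measurableEmbedding (speed γ.u γ.v) (Set.Icc γ.a γ.b)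
  rw [Set.neg_preimage, Set.neg_Icc] at h
  rw [HorizontalCurve.length, HorizontalCurve.length, ← h]
  refine MeasureTheory.lintegral_congr fun s => ?_
  simp only [γ', speed, deriv_comp_neg, neg_sq]

/-- A reparametrization of `[a, b]` over `[c, c + 1]` that is constant outside. -/
noncomputable def reparam (a b c s : ℝ) : ℝ := a + (b - a) * Real.smoothTransition (s - c)

theorem contDiff_reparam (a b c : ℝ) : ContDiff ℝ ∞ (reparam a b c) :=
  contDiff_const.add (contDiff_const.mul
    (Real.smoothTransition.contDiff.comp (contDiff_id.sub contDiff_const)))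

theorem reparam_of_le {a b c s : ℝ} (h : s ≤ c) : reparam a b c s = a := by
  simp [reparam, Real.smoothTransition.zero_of_nonpos (sub_nonpos.2 h)]

theorem reparam_of_ge {a b c s : ℝ} (h : c + 1 ≤ s) : reparam a b c s = b := by
  simp [reparam, Real.smoothTransition.one_of_one_le (le_sub_iff_add_le'.2 h)]

theorem reparam_mono {a b c : ℝ} (h : a ≤ b) : Monotone (reparam a b c) := fun s s' hs => by
  have := Real.smoothTransition.monotone (sub_le_sub_right hs c)
  have := mul_le_mul_of_nonneg_left this (sub_nonneg.2 h)
  simpa [reparam] using this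

theorem reparam_mem {a b c : ℝ} (h : a ≤ b) (s : ℝ) : reparam a b c s ∈ Set.Icc a b := by
  have h0 := Real.smoothTransition.nonneg (s - c)
  have h1 := Real.smoothTransition.le_one (s - c)
  constructor <;> rw [reparam] <;> nlinarith [sub_nonneg.2 h]

theorem deriv_reparam_of_le {a b c s : ℝ} (hab : a ≤ b) (h : s ≤ c) :
    deriv (reparam a b c) s = 0 := by
  refine IsLocalMin.deriv_eq_zero (Filter.Eventually.of_forall fun x => ?_)
  rw [reparam_of_le h]
  exact (reparam_mem hab x).1

theorem deriv_reparam_of_ge {a b c s : ℝ} (hab : a ≤ b) (h : c + 1 ≤ s) :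
    deriv (reparam a b c) s = 0 := by
  refine IsLocalMax.deriv_eq_zero (Filter.Eventually.of_forall fun x => ?_)
  rw [reparam_of_ge h]
  exact (reparam_mem hab x).2

theorem lintegral_reparam_le {a b c : ℝ} (h : a ≤ b) (f : ℝ → ℝ≥0∞) :
    ∫⁻ s in Set.Icc c (c + 1), ENNReal.ofReal (deriv (reparam a b c) s) * f (reparam a b c s)
      ≤ ∫⁻ s in Set.Icc a b, f s := by
  rw [← MeasureTheory.lintegral_image_eq_lintegral_deriv_mul_of_monotoneOn measurableSet_Icc
    (fun x _ => (((contDiff_reparam a b c).differentiable (by simp)) x).hasDerivAt.hasDerivWithinAt)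
    ((reparam_mono h).monotoneOn _)]
  refine MeasureTheory.lintegral_mono_set ?_
  rintro _ ⟨s, -, rfl⟩
  exact reparam_mem h s

theorem speed_comp {u v φ : ℝ → ℝ} {U V : ℝ → ℝ} {s : ℝ}
    (hφ : 0 ≤ deriv φ s) (h : U s = u (φ s))
    (hu : deriv U s = deriv u (φ s) * deriv φ s) (hv : deriv V s = deriv v (φ s) * deriv φ s) :
    speed U V s = ENNReal.ofReal (deriv φ s) * speed u v (φ s) := by
  rw [speed, speed, ← ENNReal.ofReal_mul hφ, h, hu, hv]
  congr 1
  rw [← Real.sqrt_sq hφ, ← Real.sqrt_mul (sq_nonneg _), Real.sqrt_sq hφ]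
  congr 1
  ring

theorem ccEDist_triangle (p q r : GrushinPlane) : ccEDist p r ≤ ccEDist p q + ccEDist q r := by
  suffices h : ∀ (γ : HorizontalCurve p q) (η : HorizontalCurve q r),
      ccEDist p r ≤ γ.length + η.length by
    rw [ccEDist.eq_1 p q, ccEDist.eq_1 q r, ENNReal.iInf_add]
    refine le_iInf fun γ => ?_
    rw [ENNReal.add_iInf]
    exact le_iInf fun η => h γ η
  intro γ η
  have hq1 : γ.u γ.b = η.u η.a :=
    (congrArg GrushinPlane.u γ.target).trans (congrArg GrushinPlane.u η.source).symm
  have hq2 : γ.v γ.b = η.v η.a :=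
    (congrArg GrushinPlane.v γ.target).trans (congrArg GrushinPlane.v η.source).symm
  let φ := reparam γ.a γ.b 0
  let ψ := reparam η.a η.b 1
  have hφ : ContDiff ℝ ∞ φ := contDiff_reparam _ _ _
  have hψ : ContDiff ℝ ∞ ψ := contDiff_reparam _ _ _
  let U : ℝ → ℝ := fun s => γ.u (φ s) + η.u (ψ s) - γ.u γ.b
  let V : ℝ → ℝ := fun s => γ.v (φ s) + η.v (ψ s) - γ.v γ.b
  have dd : ∀ {f : ℝ → ℝ}, ContDiff ℝ ∞ f → ∀ s, HasDerivAt f (deriv f s) s := fun hf s =>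
    (hf.differentiable (by simp) s).hasDerivAt
  have dU : ∀ s, deriv U s = deriv γ.u (φ s) * deriv φ s + deriv η.u (ψ s) * deriv ψ s := fun s =>
    ((((dd γ.contDiff_u (φ s)).comp s (dd hφ s)).add
      ((dd η.contDiff_u (ψ s)).comp s (dd hψ s))).sub_const _).deriv
  have dV : ∀ s, deriv V s = deriv γ.v (φ s) * deriv φ s + deriv η.v (ψ s) * deriv ψ s := fun s =>
    ((((dd γ.contDiff_v (φ s)).comp s (dd hφ s)).add
      ((dd η.contDiff_v (ψ s)).comp s (dd hψ s))).sub_const _).deriv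
  have φ0 : ∀ s, 0 ≤ deriv φ s := fun s => (reparam_mono γ.le).deriv_nonneg
  have ψ0 : ∀ s, 0 ≤ deriv ψ s := fun s => (reparam_mono η.le).deriv_nonneg
  have left : ∀ s ≤ (1 : ℝ), U s = γ.u (φ s) ∧ V s = γ.v (φ s) ∧
      deriv U s = deriv γ.u (φ s) * deriv φ s ∧ deriv V s = deriv γ.v (φ s) * deriv φ s := by
    intro s hs
    have e1 : ψ s = η.a := reparam_of_le hs
    have e2 : deriv ψ s = 0 := deriv_reparam_of_le η.le hs
    refine ⟨?_, ?_, ?_, ?_⟩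
    · simp only [U, e1]; linarith
    · simp only [V, e1]; linarith
    · rw [dU, e2]; ring
    · rw [dV, e2]; ring
  have right : ∀ s, (1 : ℝ) ≤ s → U s = η.u (ψ s) ∧ V s = η.v (ψ s) ∧
      deriv U s = deriv η.u (ψ s) * deriv ψ s ∧ deriv V s = deriv η.v (ψ s) * deriv ψ s := by
    intro s hs
    have e1 : φ s = γ.b := reparam_of_ge (by simpa using hs)
    have e2 : deriv φ s = 0 := deriv_reparam_of_ge γ.le (by simpa using hs)
    refine ⟨?_, ?_, ?_, ?_⟩
    · simp only [U, e1]; linarith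
    · simp only [V, e1]; linarith
    · rw [dU, e2]; ring
    · rw [dV, e2]; ring
  let ζ : HorizontalCurve p r :=
    { a := 0, b := 2, le := zero_le_two, u := U, v := V
      contDiff_u := ((γ.contDiff_u.comp hφ).add (η.contDiff_u.comp hψ)).sub contDiff_const
      contDiff_v := ((γ.contDiff_v.comp hφ).add (η.contDiff_v.comp hψ)).sub contDiff_const
      horizontal := by
        intro s _ h
        rcases le_total s 1 with hs | hs
        · obtain ⟨h1, -, -, h2⟩ := left s hs
          rw [h2, γ.horizontal _ (reparam_mem γ.le s) (h1 ▸ h), zero_mul]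
        · obtain ⟨h1, -, -, h2⟩ := right s hs
          rw [h2, η.horizontal _ (reparam_mem η.le s) (h1 ▸ h), zero_mul]
      source := by
        obtain ⟨h1, h2, -⟩ := left 0 zero_le_one
        rw [h1, h2, show φ 0 = γ.a from reparam_of_le le_rfl]
        exact γ.source
      target := by
        obtain ⟨h1, h2, -⟩ := right 2 one_le_two
        rw [h1, h2, show ψ 2 = η.b from reparam_of_ge (by norm_num)]
        exact η.target }
  refine (iInf_le _ ζ).trans ?_
  have hsub : Set.Icc ζ.a ζ.b ⊆ Set.Icc 0 (0 + 1) ∪ Set.Icc 1 (1 + 1) := by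
    intro s hs
    rcases le_total s 1 with h | h
    · exact Or.inl ⟨hs.1, by simpa using h⟩
    · exact Or.inr ⟨h, hs.2.trans (by simp [ζ]; norm_num)⟩
  refine (MeasureTheory.lintegral_mono_set hsub).trans
    ((MeasureTheory.lintegral_union_le _ _ _).trans (add_le_add ?_ ?_))
  · refine (le_of_eq ?_).trans (lintegral_reparam_le (c := 0) γ.le (speed γ.u γ.v))
    refine MeasureTheory.setLIntegral_congr_fun measurableSet_Icc fun s hs => ?_
    obtain ⟨h1, -, h3, h4⟩ := left s (by simpa using hs.2)
    exact speed_comp (φ0 s) h1 h3 h4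
  · refine (le_of_eq ?_).trans (lintegral_reparam_le (c := 1) η.le (speed η.u η.v))
    refine MeasureTheory.setLIntegral_congr_fun measurableSet_Icc fun s hs => ?_
    obtain ⟨h1, -, h3, h4⟩ := right s hs.1
    exact speed_comp (ψ0 s) h1 h3 h4

theorem ccEDist_horizontal_ne_top (u₁ u₂ v : ℝ) : ccEDist ⟨u₁, v⟩ ⟨u₂, v⟩ ≠ ⊤ := by
  let γ : HorizontalCurve ⟨u₁, v⟩ ⟨u₂, v⟩ :=
    { a := 0, b := 1, le := zero_le_one, u := fun s => u₁ + s * (u₂ - u₁), v := fun _ => v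
      contDiff_u := contDiff_const.add (contDiff_id.mul contDiff_const)
      contDiff_v := contDiff_const
      horizontal := by simp
      source := by simp
      target := by simp }
  refine ne_top_of_le_ne_top ?_ (iInf_le _ γ)
  simp [HorizontalCurve.length, speed, γ]

theorem ccEDist_vertical_ne_top (v₁ v₂ : ℝ) : ccEDist ⟨1, v₁⟩ ⟨1, v₂⟩ ≠ ⊤ := by
  let γ : HorizontalCurve ⟨1, v₁⟩ ⟨1, v₂⟩ :=
    { a := 0, b := 1, le := zero_le_one, u := fun _ => 1, v := fun s => v₁ + s * (v₂ - v₁)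
      contDiff_u := contDiff_const
      contDiff_v := contDiff_const.add (contDiff_id.mul contDiff_const)
      horizontal := by simp
      source := by simp
      target := by simp }
  refine ne_top_of_le_ne_top ?_ (iInf_le _ γ)
  simp [HorizontalCurve.length, speed, γ]

theorem ccEDist_ne_top (p q : GrushinPlane) : ccEDist p q ≠ ⊤ := by
  refine ne_top_of_le_ne_top ?_ (ccEDist_triangle p ⟨1, p.v⟩ q)
  refine ENNReal.add_ne_top.2 ⟨ccEDist_horizontal_ne_top _ _ _, ?_⟩
  refine ne_top_of_le_ne_top ?_ (ccEDist_triangle ⟨1, p.v⟩ ⟨1, q.v⟩ q)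
  exact ENNReal.add_ne_top.2 ⟨ccEDist_vertical_ne_top _ _, ccEDist_horizontal_ne_top _ _ _⟩

theorem enorm_deriv_u_le (u v : ℝ → ℝ) (s : ℝ) : ‖deriv u s‖ₑ ≤ speed u v s := by
  rw [speed, Real.enorm_eq_ofReal_abs]
  exact ENNReal.ofReal_le_ofReal (Real.abs_le_sqrt (le_add_of_nonneg_right (by positivity)))

theorem enorm_deriv_v_le {u v : ℝ → ℝ} {s : ℝ} (h : u s = 0 → deriv v s = 0) :
    ‖deriv v s‖ₑ ≤ ‖u s‖ₑ * speed u v s := by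
  rw [speed, Real.enorm_eq_ofReal_abs, Real.enorm_eq_ofReal_abs,
    ← ENNReal.ofReal_mul (abs_nonneg _)]
  refine ENNReal.ofReal_le_ofReal ?_
  by_cases hu : u s = 0
  · simp [h hu, hu]
  · rw [← Real.sqrt_sq_eq_abs (u s), ← Real.sqrt_mul (sq_nonneg _)]
    refine Real.abs_le_sqrt ?_
    rw [mul_add, mul_div_cancel₀ _ (pow_ne_zero 2 hu)]
    exact le_add_of_nonneg_left (by positivity)

theorem HorizontalCurve.enorm_u_sub_le {p q : GrushinPlane} (γ : HorizontalCurve p q) {s : ℝ}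
    (hs : s ∈ Set.Icc γ.a γ.b) : ‖γ.u s - γ.u γ.a‖ₑ ≤ γ.length :=
  (enorm_sub_le_lintegral_deriv_of_contDiffOn_Icc
    (γ.contDiff_u.of_le (by simp)).contDiffOn hs.1).trans
    ((MeasureTheory.lintegral_mono fun _ => enorm_deriv_u_le _ _ _).trans
      (MeasureTheory.lintegral_mono_set (Set.Icc_subset_Icc_right hs.2)))

theorem HorizontalCurve.enorm_v_sub_le {p q : GrushinPlane} (γ : HorizontalCurve p q) :
    ‖q.v - p.v‖ₑ ≤ (‖p.u‖ₑ + γ.length) * γ.length := by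
  have h1 : γ.v γ.a = p.v := congrArg GrushinPlane.v γ.source
  have h2 : γ.v γ.b = q.v := congrArg GrushinPlane.v γ.target
  have h3 : γ.u γ.a = p.u := congrArg GrushinPlane.u γ.source
  by_cases hl : γ.length = ⊤
  · simp [hl]
  rw [← h1, ← h2]
  refine (enorm_sub_le_lintegral_deriv_of_contDiffOn_Icc
    (γ.contDiff_v.of_le (by simp)).contDiffOn γ.le).trans ?_
  nth_rewrite 2 [HorizontalCurve.length]
  rw [← MeasureTheory.lintegral_const_mul' _ _ (ENNReal.add_ne_top.2 ⟨by simp, hl⟩)]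
  refine MeasureTheory.setLIntegral_mono' measurableSet_Icc fun s hs => ?_
  refine (enorm_deriv_v_le (γ.horizontal s hs)).trans (mul_le_mul_left ?_ _)
  rw [← h3]
  calc ‖γ.u s‖ₑ = ‖γ.u γ.a + (γ.u s - γ.u γ.a)‖ₑ := by rw [add_sub_cancel]
    _ ≤ ‖γ.u γ.a‖ₑ + ‖γ.u s - γ.u γ.a‖ₑ := enorm_add_le _ _
    _ ≤ _ := by gcongr; exact γ.enorm_u_sub_le hs

theorem eq_of_ccEDist_eq_zero {p q : GrushinPlane} (h : ccEDist p q = 0) : p = q := by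
  have hex : ∀ ε : ℝ≥0∞, 0 < ε → ∃ γ : HorizontalCurve p q, γ.length < ε := fun ε hε =>
    iInf_lt_iff.1 (by rw [← ccEDist, h]; exact hε)
  have hu : ‖q.u - p.u‖ₑ = 0 := by
    by_contra hne
    obtain ⟨γ, hγ⟩ := hex _ (pos_iff_ne_zero.2 hne)
    have := γ.enorm_u_sub_le (Set.right_mem_Icc.2 γ.le)
    rw [show γ.u γ.a = p.u from congrArg GrushinPlane.u γ.source,
      show γ.u γ.b = q.u from congrArg GrushinPlane.u γ.target] at this
    exact absurd this (not_le.2 hγ)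
  have hv : ‖q.v - p.v‖ₑ = 0 := by
    by_contra hne
    have hc : ‖p.u‖ₑ + 1 ≠ ⊤ := by simp
    have hc0 : ‖p.u‖ₑ + 1 ≠ 0 := by simp
    obtain ⟨γ, hγ⟩ := hex (min 1 (‖q.v - p.v‖ₑ / (‖p.u‖ₑ + 1)))
      (lt_min one_pos (ENNReal.div_pos hne hc))
    have h1 : γ.length ≤ 1 := (hγ.trans_le (min_le_left _ _)).le
    have h2 := hγ.trans_le (min_le_right _ _)
    rw [ENNReal.lt_div_iff_mul_lt (Or.inl hc0) (Or.inl hc), mul_comm] at h2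
    exact absurd (γ.enorm_v_sub_le.trans (mul_le_mul_left (add_le_add_right h1 _) _))
      (not_le.2 h2)
  rw [enorm_eq_zero, sub_eq_zero] at hu hv
  ext
  · exact hu.symm
  · exact hv.symm

/-- The extended metric given by the Carnot–Carathéodory distance. -/
noncomputable abbrev ccEMetricSpace : EMetricSpace GrushinPlane where
  edist := ccEDist
  edist_self := ccEDist_self
  edist_comm p q := le_antisymm (ccEDist_le_symm p q) (ccEDist_le_symm q p)
  edist_triangle := ccEDist_triangle
  eq_of_edist_eq_zero := eq_of_ccEDist_eq_zero

/-- The Grushin plane with its Carnot–Carathéodory metric. -/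
noncomputable instance : MetricSpace GrushinPlane :=
  @EMetricSpace.toMetricSpace GrushinPlane ccEMetricSpace ccEDist_ne_top

theorem edist_eq_ccEDist (p q : GrushinPlane) : edist p q = ccEDist p q := rfl

end GrushinPlane

/-- An identification of the space of right cosets of `V`, with the distance induced by the
Carnot–Carathéodory metric of the Heisenberg group, with the Grushin plane: an isometric
bijection. -/
def IsGrushinIdentification (V : Subgroup Heis) (Φ : Heis.RightCosets V ≃ GrushinPlane) : Prop :=
  ∀ A B : Heis.RightCosets V, edist (Φ A) (Φ B) = Heis.cosetCCEDist V A B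

/-- The map `π^R` from the Heisenberg group to the Grushin plane: the quotient map onto the right
cosets of `V` followed by the identification `Φ`. -/
def rightCosetProjection (V : Subgroup Heis) (Φ : Heis.RightCosets V ≃ GrushinPlane) (p : Heis) :
    GrushinPlane :=
  Φ (Heis.toRightCoset V p)

/-! Let `(a, b)` be a unit vector of the line, `y` and `u` the horizontal coordinates along and
across it, and `v = (t + 2yu)/4`. Then `(u, v)` is a complete invariant of the right coset and `y`
parametrizes the coset. A horizontal curve satisfies `v' = u y'` and has speed `√(y'² + u'²)`, which
is the Grushin speed wherever `u ≠ 0`. Hence projecting does not increase length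
(`ccEDist_toGrushin_le`).

Conversely a Grushin curve should be lifted by integrating `y' = v'/u`, but this quotient need not
be smooth at the zeros of `u`. It is only integrable, with norm at most the length. It is replaced
by a smooth `h`, close to it in `L¹` and with the same `∫ u h`: the lift is then smooth, almost as
short, and ends over the correct point (`exists_contDiff_lift`, `exists_ccEDist_lt_of_toGrushin`).
Since the lift may start anywhere on the fibre, the coset distance equals the Grushin distance.

For the Lipschitz bound, right multiplication by `g` acts on `(u, v)` as a projected horizontal
segment followed by a vertical shift of `g.t/4`. Projected circles show that a vertical shift `τ`
costs at most a multiple of `√|τ|`.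

For the covering, if `p` lies over a point at distance less than `r` from `w`, the approximate lift
has some displacement `δ` along the line with `|δ| ≤ r`, and `w.v` is `p.v + p.u δ` up to `r²`
(`exists_shift_of_dist_lt`). So `p` is `O(r)`-close to the point of the fibre over `w` with
coordinate `y(p) + δ`. Fibres with `u ≠ 0` are not horizontal, so an error `e` in that coordinate
can cost `√|e|`; an `r²`-net of a bounded piece of the fibre suffices and has `O(r⁻²)` points.

Any two identifications induce the same distances on cosets, so one explicit identification settles
all of them. -/

/-! ### `L¹` approximation under an integral constraint -/

open MeasureTheory Set in
/-- Polynomials are dense in `L¹[a, b]`. -/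
theorem exists_polynomial_setIntegral_abs_sub_le {a b : ℝ} {g : ℝ → ℝ}
    (hg : IntegrableOn g (Icc a b)) {ε : ℝ} (hε : 0 < ε) :
    ∃ P : Polynomial ℝ, ∫ x in Icc a b, |g x - P.eval x| ≤ ε := by
  obtain ⟨f, -, hf, hfc, hfi⟩ :=
    Integrable.exists_hasCompactSupport_integral_sub_le hg (half_pos hε)
  have hm : 0 ≤ (volume : Measure ℝ).real (Icc a b) := measureReal_nonneg
  set m := (volume : Measure ℝ).real (Icc a b)
  -- `m + 1` instead of `m` keeps the tolerance meaningful when the interval has measure zero.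
  obtain ⟨P, hP⟩ := exists_polynomial_near_of_continuousOn a b f hfc.continuousOn
    (ε / (2 * (m + 1))) (by positivity)
  have hPi : IntegrableOn (fun x => P.eval x) (Icc a b) :=
    P.continuous.continuousOn.integrableOn_compact isCompact_Icc
  have h2 : ∫ x in Icc a b, |f x - P.eval x| ≤ ε / 2 := by
    calc ∫ x in Icc a b, |f x - P.eval x| ≤ ∫ x in Icc a b, ε / (2 * (m + 1)) := by
          refine setIntegral_mono_on (hfi.sub hPi).abs (by simp) measurableSet_Icc fun x hx => ?_
          rw [abs_sub_comm]
          exact (hP x hx).le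
      _ = m * (ε / (2 * (m + 1))) := by rw [setIntegral_const, smul_eq_mul]
      _ ≤ ε / 2 := by
          rw [mul_div_assoc', div_le_div_iff₀ (by positivity) (by positivity)]
          nlinarith
  refine ⟨P, ?_⟩
  calc ∫ x in Icc a b, |g x - P.eval x|
      ≤ ∫ x in Icc a b, (‖g x - f x‖ + |f x - P.eval x|) :=
        integral_mono (hg.sub hPi).abs ((hg.sub hfi).norm.add (hfi.sub hPi).abs) fun x =>
          abs_sub_le _ _ _
    _ = (∫ x in Icc a b, ‖g x - f x‖) + ∫ x in Icc a b, |f x - P.eval x| :=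
        integral_add (hg.sub hfi).norm (hfi.sub hPi).abs
    _ ≤ ε := by linarith

open MeasureTheory Set in
/-- Smooth functions with a prescribed integral against a smooth weight `u` are dense among the
integrable functions with that integral. -/
theorem exists_contDiff_setIntegral_mul_eq {a b : ℝ} {u g : ℝ → ℝ} (hu : ContDiff ℝ ∞ u)
    (hg : IntegrableOn g (Icc a b)) {ε : ℝ} (hε : 0 < ε) :
    ∃ h : ℝ → ℝ, ContDiff ℝ ∞ h ∧ ∫ x in Icc a b, |g x - h x| ≤ ε ∧
      ∫ x in Icc a b, u x * h x = ∫ x in Icc a b, u x * g x := by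
  have hci : ∀ {f : ℝ → ℝ}, Continuous f → IntegrableOn f (Icc a b) := fun hf =>
    hf.continuousOn.integrableOn_compact isCompact_Icc
  have huc : Continuous u := hu.continuous
  have huu : IntegrableOn (fun x => u x * u x) (Icc a b) := hci (huc.mul huc)
  obtain ⟨M, hM⟩ := isCompact_Icc.exists_bound_of_continuousOn (s := Icc a b) huc.continuousOn
  have hmul : ∀ {f : ℝ → ℝ}, IntegrableOn f (Icc a b) →
      IntegrableOn (fun x => u x * f x) (Icc a b) := fun hf =>
    hf.continuousOn_mul huc.continuousOn isCompact_Icc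
  set D := ∫ x in Icc a b, u x * u x with hD
  set A := ∫ x in Icc a b, |u x| with hA
  have hD0 : 0 ≤ D := integral_nonneg fun x => mul_self_nonneg _
  have hA0 : 0 ≤ A := integral_nonneg fun x => abs_nonneg _
  -- The answer will be `P + (E / D) u`, where `E` is the defect of the weighted integral of `P`. If
  -- `P` is `ε / k`-close to `g`, the correction costs at most `(max M 0 * A / D) * (ε / k)`, so `k`
  -- makes the total exactly `ε`.
  set k := 1 + max M 0 * A / D with hk
  have hk0 : 0 < k := by positivity
  obtain ⟨P, hP⟩ := exists_polynomial_setIntegral_abs_sub_le hg (div_pos hε hk0)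
  have hPi : IntegrableOn (fun x => P.eval x) (Icc a b) := hci P.continuous
  set E := ∫ x in Icc a b, u x * (g x - P.eval x) with hE
  have hEle : |E| ≤ max M 0 * (ε / k) := by
    calc |E| ≤ ∫ x in Icc a b, |u x * (g x - P.eval x)| := abs_integral_le_integral_abs
      _ ≤ ∫ x in Icc a b, max M 0 * |g x - P.eval x| := by
          refine setIntegral_mono_on (hmul (hg.sub hPi)).abs ((hg.sub hPi).abs.const_mul _)
            measurableSet_Icc fun x hx => ?_
          rw [abs_mul]
          exact mul_le_mul_of_nonneg_right ((hM x hx).trans (le_max_left _ _)) (abs_nonneg _)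
      _ = max M 0 * ∫ x in Icc a b, |g x - P.eval x| := integral_const_mul _ _
      _ ≤ _ := mul_le_mul_of_nonneg_left hP (le_max_right _ _)
  -- If `D = 0` then `u` vanishes almost everywhere, so `E = 0` and no correction is needed;
  -- division by zero gives the right value.
  have hED : E / D * D = E := by
    by_cases h : D = 0
    · have h0 := (integral_eq_zero_iff_of_nonneg (fun x => mul_self_nonneg _) huu).1 h
      have : E = 0 := by
        refine integral_eq_zero_of_ae ?_
        filter_upwards [h0] with x hx
        rw [mul_self_eq_zero.1 hx]
        simp
      rw [this]; simp
    · exact div_mul_cancel₀ _ h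
  have hui : IntegrableOn (fun x => E / D * u x) (Icc a b) := hci (huc.const_mul _)
  refine ⟨fun x => P.eval x + E / D * u x, (by simpa using P.contDiff_aeval (𝕜 := ℝ) ∞ : ContDiff ℝ ∞ fun x => P.eval x).add
    (contDiff_const.mul hu), ?_, ?_⟩
  · calc ∫ x in Icc a b, |g x - (P.eval x + E / D * u x)|
        ≤ ∫ x in Icc a b, (|g x - P.eval x| + |E / D| * |u x|) := by
          refine integral_mono (hg.sub (hPi.add hui)).abs
            ((hg.sub hPi).abs.add ((hci huc).abs.const_mul _)) fun x => ?_
          dsimp only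
          rw [← abs_mul, ← sub_sub]
          exact abs_sub _ _
      _ = (∫ x in Icc a b, |g x - P.eval x|) + |E / D| * A := by
          rw [hA, ← integral_const_mul]
          exact integral_add (hg.sub hPi).abs ((hci huc).abs.const_mul _)
      _ ≤ ε / k + max M 0 * (ε / k) / D * A := by
          rw [abs_div, abs_of_nonneg hD0]
          gcongr
      _ = ε / k * k := by rw [hk]; ring
      _ = ε := div_mul_cancel₀ _ hk0.ne'
  · have e1 : ∫ x in Icc a b, u x * (P.eval x + E / D * u x)
        = (∫ x in Icc a b, u x * P.eval x) + E / D * D := by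
      rw [hD, ← integral_const_mul, ← integral_add (hmul hPi) (huu.const_mul _)]
      congr 1 with x
      ring
    have e2 : E = (∫ x in Icc a b, u x * g x) - ∫ x in Icc a b, u x * P.eval x := by
      rw [hE, ← integral_sub (hmul hg) (hmul hPi)]
      congr 1 with x
      ring
    rw [e1, hED, e2]
    ring

/-! ### Approximate smooth lifts of Grushin curves -/

namespace GrushinPlane

open MeasureTheory Set in
/-- A Grushin curve of length less than `l` has an approximate angular speed `h`: smooth, with the
same increment `∫ u h` of the second coordinate, and such that the planar curve of velocity
`(h, u')` has length less than `l`. -/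
theorem HorizontalCurve.exists_contDiff_lift {p q : GrushinPlane} (γ : HorizontalCurve p q)
    {l : ℝ≥0∞} (hl : γ.length < l) :
    ∃ h : ℝ → ℝ, ContDiff ℝ ∞ h ∧ ∫ s in γ.a..γ.b, γ.u s * h s = q.v - p.v ∧
      ∫⁻ s in Icc γ.a γ.b, ENNReal.ofReal (√((h s) ^ 2 + (deriv γ.u s) ^ 2)) < l := by
  -- At zeros of `u` this is `0` by convention, and horizontality gives `v' = 0` there, so `u g =
  -- v'` on the whole interval.
  set g : ℝ → ℝ := fun s => deriv γ.v s / γ.u s with hg_def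
  have hdv : Continuous (deriv γ.v) := γ.contDiff_v.continuous_deriv (by simp)
  have hgm : Measurable g := hdv.measurable.div γ.contDiff_u.continuous.measurable
  have hspeed : ∀ s, speed γ.u γ.v s = ENNReal.ofReal (√((g s) ^ 2 + (deriv γ.u s) ^ 2)) := by
    intro s
    simp only [hg_def, speed, div_pow, add_comm]
  have hgi : IntegrableOn g (Icc γ.a γ.b) := by
    refine ⟨hgm.aestronglyMeasurable, (lt_of_le_of_lt (lintegral_mono fun s => ?_)
      (hl.trans_le le_top) : _ < ⊤)⟩
    rw [hspeed, Real.enorm_eq_ofReal_abs]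
    exact ENNReal.ofReal_le_ofReal (Real.abs_le_sqrt (le_add_of_nonneg_right (by positivity)))
  obtain ⟨ε, hε0, hε⟩ : ∃ ε : ℝ, 0 < ε ∧ γ.length + ENNReal.ofReal ε < l := by
    obtain ⟨ε, hε0, hε⟩ := ENNReal.lt_iff_exists_add_pos_lt.1 hl
    exact ⟨ε, hε0, by simpa using hε⟩
  obtain ⟨h, hh, hgh, heq⟩ := exists_contDiff_setIntegral_mul_eq γ.contDiff_u hgi hε0
  have hhi : IntegrableOn h (Icc γ.a γ.b) :=
    hh.continuous.continuousOn.integrableOn_compact isCompact_Icc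
  refine ⟨h, hh, ?_, lt_of_le_of_lt ?_ hε⟩
  · have h1 : γ.v γ.a = p.v := congrArg GrushinPlane.v γ.source
    have h2 : γ.v γ.b = q.v := congrArg GrushinPlane.v γ.target
    rw [intervalIntegral.integral_of_le γ.le, ← integral_Icc_eq_integral_Ioc, heq, ← h1, ← h2,
      ← intervalIntegral.integral_eq_sub_of_hasDerivAt
        (fun s _ => (γ.contDiff_v.differentiable (by simp) s).hasDerivAt)
        (hdv.intervalIntegrable _ _),
      intervalIntegral.integral_of_le γ.le, ← integral_Icc_eq_integral_Ioc]
    refine setIntegral_congr_fun measurableSet_Icc fun s hs => ?_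
    by_cases hu : γ.u s = 0
    · simp [hu, γ.horizontal s hs hu]
    · simp only [hg_def]
      field_simp
  · calc ∫⁻ s in Icc γ.a γ.b, ENNReal.ofReal (√((h s) ^ 2 + (deriv γ.u s) ^ 2))
        ≤ ∫⁻ s in Icc γ.a γ.b, (speed γ.u γ.v s + ENNReal.ofReal |g s - h s|) := by
          refine lintegral_mono fun s => ?_
          rw [hspeed, ← ENNReal.ofReal_add (by positivity) (by positivity)]
          refine ENNReal.ofReal_le_ofReal ?_
          -- Changing one component of a planar velocity changes its norm by at most the size of the
          -- change.
          have := norm_sub_norm_le (⟨h s, deriv γ.u s⟩ : ℂ) ⟨g s, deriv γ.u s⟩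
          have e : (⟨h s, deriv γ.u s⟩ : ℂ) - ⟨g s, deriv γ.u s⟩ = ((h s - g s : ℝ) : ℂ) := by
            apply Complex.ext <;> simp
          rw [e, Complex.norm_real, Complex.norm_def, Complex.norm_def, Complex.normSq_mk,
            Complex.normSq_mk, Real.norm_eq_abs, abs_sub_comm] at this
          simp only [pow_two]
          linarith
      _ = γ.length + ENNReal.ofReal (∫ s in Icc γ.a γ.b, |g s - h s|) := by
          have hm : Measurable fun s => ENNReal.ofReal |g s - h s| :=
            (continuous_abs.measurable.comp
              (hgm.sub hh.continuous.measurable)).ennreal_ofReal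
          have e := ofReal_integral_eq_lintegral_ofReal (f := fun s => |g s - h s|)
            (μ := volume.restrict (Icc γ.a γ.b)) (hgi.sub hhi).abs
            (Filter.Eventually.of_forall fun s => abs_nonneg _)
          rw [lintegral_add_right _ hm, e]
          rfl
      _ ≤ _ := by gcongr

end GrushinPlane

/-! ### Grushin coordinates on right cosets and the isometry -/

namespace Heis

/-- The horizontal coordinate of `p` along the direction `(a, b)`. -/
def along (a b : ℝ) (p : Heis) : ℝ := a * p.x1 + b * p.x2

/-- The horizontal coordinate of `p` across the direction `(a, b)`. -/
def across (a b : ℝ) (p : Heis) : ℝ := a * p.x2 - b * p.x1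

/-- Grushin coordinates on the right cosets of the horizontal line of direction `(a, b)`. -/
noncomputable def toGrushin (a b : ℝ) (p : Heis) : GrushinPlane :=
  ⟨across a b p, (p.t + 2 * along a b p * across a b p) / 4⟩

/-- The point with coordinate `y` along `(a, b)` on the fibre of `toGrushin a b` over `(u, v)`. -/
def ofGrushin (a b y u v : ℝ) : Heis := ⟨a * y - b * u, b * y + a * u, 4 * v - 2 * y * u⟩

variable {a b : ℝ}

theorem along_ofGrushin (h : a ^ 2 + b ^ 2 = 1) (y u v : ℝ) :
    along a b (ofGrushin a b y u v) = y := by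
  simp only [along, ofGrushin]
  linear_combination y * h

theorem across_ofGrushin (h : a ^ 2 + b ^ 2 = 1) (y u v : ℝ) :
    across a b (ofGrushin a b y u v) = u := by
  simp only [across, ofGrushin]
  linear_combination u * h

theorem toGrushin_ofGrushin (h : a ^ 2 + b ^ 2 = 1) (y u v : ℝ) :
    toGrushin a b (ofGrushin a b y u v) = ⟨u, v⟩ := by
  ext
  · exact across_ofGrushin h y u v
  · simp only [toGrushin, along_ofGrushin h, across_ofGrushin h]
    simp only [ofGrushin]
    ring

theorem ofGrushin_toGrushin (h : a ^ 2 + b ^ 2 = 1) (p : Heis) :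
    ofGrushin a b (along a b p) (toGrushin a b p).u (toGrushin a b p).v = p := by
  ext <;> simp only [toGrushin, ofGrushin, along, across]
  · linear_combination p.x1 * h
  · linear_combination p.x2 * h
  · ring

theorem IsHorizontalLine.exists_unit {V : Subgroup Heis} (hV : IsHorizontalLine V) :
    ∃ a b : ℝ, a ^ 2 + b ^ 2 = 1 ∧ ∀ p : Heis, p ∈ V ↔ ∃ s : ℝ, p = ⟨s * a, s * b, 0⟩ := by
  obtain ⟨a, b, hab, hV⟩ := hV
  have hpos : 0 < a ^ 2 + b ^ 2 := by
    rcases eq_or_ne a 0 with rfl | ha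
    · have hb : b ≠ 0 := fun hb => hab (by rw [hb])
      positivity
    · positivity
  have hr := Real.sqrt_pos.2 hpos
  have hr2 := Real.sq_sqrt hpos.le
  set r := √(a ^ 2 + b ^ 2)
  refine ⟨a / r, b / r, ?_, fun p => ?_⟩
  · field_simp
    exact hr2.symm
  · rw [← SetLike.mem_coe, hV]
    constructor
    · rintro ⟨s, rfl⟩
      refine ⟨s * r, ?_⟩
      ext <;> simp <;> field_simp
    · rintro ⟨s, rfl⟩
      refine ⟨s / r, ?_⟩
      ext <;> simp <;> field_simp

/-- Left multiplication by `(sa, sb, 0)` adds `s` to the coordinate along the line and fixes the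
Grushin coordinates, so the difference of the former coordinates names the element of `V` relating
two points of a fibre. -/
theorem toRightCoset_eq_iff {V : Subgroup Heis} (h : a ^ 2 + b ^ 2 = 1)
    (hV : ∀ p : Heis, p ∈ V ↔ ∃ s : ℝ, p = ⟨s * a, s * b, 0⟩) (p q : Heis) :
    toRightCoset V p = toRightCoset V q ↔ toGrushin a b p = toGrushin a b q := by
  rw [toRightCoset, toRightCoset, Quotient.eq]
  rw [QuotientGroup.rightRel_apply, hV]
  constructor
  · rintro ⟨s, hs⟩
    obtain rfl : q = ⟨s * a, s * b, 0⟩ * p := by rw [← hs]; group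
    ext <;> simp only [toGrushin, along, across, mul_x1, mul_x2, mul_t]
    · ring
    · linear_combination (-s / 2 * (a * p.x2 - b * p.x1)) * h
  · intro hpq
    refine ⟨along a b q - along a b p, ?_⟩
    rw [← ofGrushin_toGrushin h p, ← ofGrushin_toGrushin h q, hpq]
    simp only [along_ofGrushin h]
    ext <;> simp only [ofGrushin, mul_x1, mul_x2, mul_t, inv_x1, inv_x2, inv_t]
    · ring
    · ring
    · linear_combination (2 * (along a b q - along a b p) * (toGrushin a b q).u) * h

theorem toGrushin_surjective (h : a ^ 2 + b ^ 2 = 1) : Function.Surjective (toGrushin a b) :=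
  fun w => ⟨ofGrushin a b 0 w.u w.v, toGrushin_ofGrushin h 0 w.u w.v⟩

/-- The Grushin coordinates, as a bijection from the right cosets of the line `V` of direction
`(a, b)`. -/
noncomputable def cosetEquiv {V : Subgroup Heis} (h : a ^ 2 + b ^ 2 = 1)
    (hV : ∀ p : Heis, p ∈ V ↔ ∃ s : ℝ, p = ⟨s * a, s * b, 0⟩) : RightCosets V ≃ GrushinPlane :=
  Equiv.ofBijective
    (Quotient.lift (toGrushin a b) fun p q hpq =>
      (toRightCoset_eq_iff h hV p q).1 (Quotient.sound hpq))
    ⟨by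
      rintro ⟨p⟩ ⟨q⟩ hpq
      exact (toRightCoset_eq_iff h hV p q).2 hpq,
    fun w => (toGrushin_surjective h w).elim fun p hp => ⟨toRightCoset V p, hp⟩⟩

theorem cosetEquiv_toRightCoset {V : Subgroup Heis} (h : a ^ 2 + b ^ 2 = 1)
    (hV : ∀ p : Heis, p ∈ V ↔ ∃ s : ℝ, p = ⟨s * a, s * b, 0⟩) (p : Heis) :
    cosetEquiv h hV (toRightCoset V p) = toGrushin a b p := rfl

open MeasureTheory Set in
/-- Grushin coordinates do not increase the Carnot–Carathéodory distance. -/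
theorem ccEDist_toGrushin_le (h : a ^ 2 + b ^ 2 = 1) (p q : Heis) :
    GrushinPlane.ccEDist (toGrushin a b p) (toGrushin a b q) ≤ ccEDist p q := by
  refine le_iInf fun γ => ?_
  have d1 : ∀ s, HasDerivAt γ.x1 (deriv γ.x1 s) s := fun s =>
    (γ.contDiff_x1.differentiable (by simp) s).hasDerivAt
  have d2 : ∀ s, HasDerivAt γ.x2 (deriv γ.x2 s) s := fun s =>
    (γ.contDiff_x2.differentiable (by simp) s).hasDerivAt
  have d3 : ∀ s, HasDerivAt γ.t (deriv γ.t s) s := fun s =>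
    (γ.contDiff_t.differentiable (by simp) s).hasDerivAt
  let y : ℝ → ℝ := fun s => a * γ.x1 s + b * γ.x2 s
  let u : ℝ → ℝ := fun s => a * γ.x2 s - b * γ.x1 s
  let v : ℝ → ℝ := fun s => (γ.t s + 2 * y s * u s) / 4
  have cy : ContDiff ℝ ∞ y :=
    (contDiff_const.mul γ.contDiff_x1).add (contDiff_const.mul γ.contDiff_x2)
  have cu : ContDiff ℝ ∞ u :=
    (contDiff_const.mul γ.contDiff_x2).sub (contDiff_const.mul γ.contDiff_x1)
  have cv : ContDiff ℝ ∞ v := (γ.contDiff_t.add ((contDiff_const.mul cy).mul cu)).div_const _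
  have dy : ∀ s, HasDerivAt y (a * deriv γ.x1 s + b * deriv γ.x2 s) s := fun s =>
    ((d1 s).const_mul a).add ((d2 s).const_mul b)
  have du : ∀ s, HasDerivAt u (a * deriv γ.x2 s - b * deriv γ.x1 s) s := fun s =>
    ((d2 s).const_mul a).sub ((d1 s).const_mul b)
  have dv : ∀ s ∈ Icc γ.a γ.b,
      deriv v s = u s * (a * deriv γ.x1 s + b * deriv γ.x2 s) := by
    intro s hs
    obtain ⟨c, d, hcd⟩ := Submodule.mem_span_pair.1 (γ.horizontal s hs)
    simp only [X1, X2, Prod.smul_mk, Prod.mk_add_mk, Prod.mk.injEq, smul_eq_mul] at hcd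
    obtain ⟨e1, e2, e3⟩ := hcd
    have e1 : c = deriv γ.x1 s := by linarith
    have e2 : d = deriv γ.x2 s := by linarith
    have hv : HasDerivAt v _ s := ((d3 s).add (((dy s).const_mul 2).mul (du s))).div_const 4
    rw [hv.deriv, ← e3, e1, e2]
    simp only [y, u]
    linear_combination ((γ.x1 s * deriv γ.x2 s - γ.x2 s * deriv γ.x1 s) / 2) * h
  let η : GrushinPlane.HorizontalCurve (toGrushin a b p) (toGrushin a b q) :=
    { a := γ.a, b := γ.b, le := γ.le, u := u, v := v
      contDiff_u := cu
      contDiff_v := cv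
      horizontal := fun s hs h0 => by rw [dv s hs, h0, zero_mul]
      source := congrArg (toGrushin a b) γ.source
      target := congrArg (toGrushin a b) γ.target }
  refine (iInf_le _ η).trans (setLIntegral_mono' measurableSet_Icc fun s hs => ?_)
  refine ENNReal.ofReal_le_ofReal (Real.sqrt_le_sqrt ?_)
  change (deriv u s) ^ 2 + (deriv v s) ^ 2 / (u s) ^ 2 ≤ _
  rw [(du s).deriv, dv s hs]
  -- Only an inequality: at zeros of `u` the left side is `0`, whatever the velocity along the line.
  have key : (u s * (a * deriv γ.x1 s + b * deriv γ.x2 s)) ^ 2 / (u s) ^ 2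
      ≤ (a * deriv γ.x1 s + b * deriv γ.x2 s) ^ 2 := by
    rw [mul_pow]
    exact div_le_of_le_mul₀ (sq_nonneg _) (sq_nonneg _) (mul_comm _ _).le
  refine (add_le_add_right key _).trans (le_of_eq ?_)
  linear_combination ((deriv γ.x1 s) ^ 2 + (deriv γ.x2 s) ^ 2) * h

open MeasureTheory Set in
/-- A Grushin curve lifts, up to an arbitrarily small loss of length, to a horizontal curve from
any given point of the fibre over its source. -/
theorem exists_ccEDist_lt_of_toGrushin (h : a ^ 2 + b ^ 2 = 1) (p : Heis) (w : GrushinPlane)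
    {l : ℝ≥0∞} (hl : GrushinPlane.ccEDist (toGrushin a b p) w < l) :
    ∃ q : Heis, toGrushin a b q = w ∧ ccEDist p q < l := by
  obtain ⟨γ, hγ⟩ := iInf_lt_iff.1 hl
  obtain ⟨f, hf, hint, hlen⟩ := γ.exists_contDiff_lift hγ
  have prim : ∀ {g : ℝ → ℝ} (_ : ContDiff ℝ ∞ g) (c : ℝ),
      (∀ s, HasDerivAt (fun s => c + ∫ x in γ.a..s, g x) (g s) s) ∧
      ContDiff ℝ ∞ (fun s => c + ∫ x in γ.a..s, g x) := by
    intro g hg c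
    have hd : ∀ s, HasDerivAt (fun s => c + ∫ x in γ.a..s, g x) (g s) s := fun s =>
      ((hg.continuous.integral_hasStrictDerivAt γ.a s).hasDerivAt).const_add c
    refine ⟨hd, contDiff_infty_iff_deriv.2 ⟨fun s => (hd s).differentiableAt, ?_⟩⟩
    rwa [funext fun s => (hd s).deriv]
  obtain ⟨dy, cy⟩ := prim hf (along a b p)
  obtain ⟨dv, cv⟩ := prim (γ.contDiff_u.mul hf) (toGrushin a b p).v
  have cu := γ.contDiff_u
  have du : ∀ s, HasDerivAt γ.u (deriv γ.u s) s := fun s =>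
    (cu.differentiable (by simp) s).hasDerivAt
  set y : ℝ → ℝ := fun s => along a b p + ∫ x in γ.a..s, f x
  set v : ℝ → ℝ := fun s => (toGrushin a b p).v + ∫ x in γ.a..s, γ.u x * f x
  have hua : γ.u γ.a = (toGrushin a b p).u := congrArg GrushinPlane.u γ.source
  have hub : γ.u γ.b = w.u := congrArg GrushinPlane.u γ.target
  have hvb : v γ.b = w.v := by simp only [v, hint]; ring
  have dx1 : ∀ s, HasDerivAt (fun s => a * y s - b * γ.u s) (a * f s - b * deriv γ.u s) s :=
    fun s => ((dy s).const_mul a).sub ((du s).const_mul b)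
  have dx2 : ∀ s, HasDerivAt (fun s => b * y s + a * γ.u s) (b * f s + a * deriv γ.u s) s :=
    fun s => ((dy s).const_mul b).add ((du s).const_mul a)
  have dt : ∀ s, HasDerivAt (fun s => 4 * v s - 2 * y s * γ.u s)
      (4 * (γ.u s * f s) - (2 * f s * γ.u s + 2 * y s * deriv γ.u s)) s :=
    fun s => ((dv s).const_mul 4).sub (((dy s).const_mul 2).mul (du s))
  -- The final value of `y` is not controlled, and need not be: only the coset of the endpoint
  -- matters.
  let η : HorizontalCurve p (ofGrushin a b (y γ.b) (γ.u γ.b) (v γ.b)) :=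
    { a := γ.a, b := γ.b, le := γ.le
      x1 := fun s => a * y s - b * γ.u s
      x2 := fun s => b * y s + a * γ.u s
      t := fun s => 4 * v s - 2 * y s * γ.u s
      contDiff_x1 := (contDiff_const.mul cy).sub (contDiff_const.mul cu)
      contDiff_x2 := (contDiff_const.mul cy).add (contDiff_const.mul cu)
      contDiff_t := (contDiff_const.mul cv).sub ((contDiff_const.mul cy).mul cu)
      horizontal := by
        intro s _
        rw [(dx1 s).deriv, (dx2 s).deriv, (dt s).deriv]
        refine Submodule.mem_span_pair.2
          ⟨a * f s - b * deriv γ.u s, b * f s + a * deriv γ.u s, ?_⟩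
        simp only [X1, X2, Prod.smul_mk, Prod.mk_add_mk, Prod.mk.injEq, smul_eq_mul]
        refine ⟨by ring, by ring, ?_⟩
        linear_combination (2 * γ.u s * f s - 2 * y s * deriv γ.u s) * h
      source := by
        have e1 : y γ.a = along a b p := by simp [y]
        have e2 : v γ.a = (toGrushin a b p).v := by simp [v]
        rw [e1, e2, hua]
        exact ofGrushin_toGrushin h p
      target := rfl }
  refine ⟨_, ?_, (iInf_le _ η).trans_lt (lt_of_eq_of_lt ?_ hlen)⟩
  · rw [toGrushin_ofGrushin h, hub, hvb]
  · refine lintegral_congr fun s => ?_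
    congr 2
    change (deriv (fun s => a * y s - b * γ.u s) s) ^ 2
      + (deriv (fun s => b * y s + a * γ.u s) s) ^ 2 = _
    rw [(dx1 s).deriv, (dx2 s).deriv]
    linear_combination ((f s) ^ 2 + (deriv γ.u s) ^ 2) * h

/-- One inequality is projection of curves. The other is lifting, for which any representative of
`A` serves as starting point. -/
theorem isGrushinIdentification_cosetEquiv {V : Subgroup Heis} (h : a ^ 2 + b ^ 2 = 1)
    (hV : ∀ p : Heis, p ∈ V ↔ ∃ s : ℝ, p = ⟨s * a, s * b, 0⟩) :
    IsGrushinIdentification V (cosetEquiv h hV) := by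
  intro A B
  rw [GrushinPlane.edist_eq_ccEDist]
  refine le_antisymm ?_ (le_of_forall_gt fun l hl => ?_)
  · refine le_iInf₂ fun p hp => le_iInf₂ fun q hq => ?_
    rw [← hp, ← hq, cosetEquiv_toRightCoset, cosetEquiv_toRightCoset]
    exact ccEDist_toGrushin_le h p q
  · obtain ⟨p, rfl⟩ := Quotient.exists_rep A
    obtain ⟨q, hq, hpq⟩ := exists_ccEDist_lt_of_toGrushin h p (cosetEquiv h hV B) hl
    refine lt_of_le_of_lt ?_ hpq
    exact iInf₂_le_of_le p rfl (iInf₂_le q ((cosetEquiv h hV).injective hq))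

end Heis

/-! ### Distance estimates and properness of the Grushin plane -/

/-- A metric space that is the continuous image of a proper space is proper if the preimages of
the balls about one point are bounded. -/
theorem properSpace_of_continuous_surjective {X Y : Type*} [MetricSpace X] [MetricSpace Y]
    [ProperSpace Y] {f : Y → X} (hf : Continuous f) (hs : Function.Surjective f) (x : X)
    (hb : ∀ r, Bornology.IsBounded (f ⁻¹' Metric.closedBall x r)) : ProperSpace X := by
  refine ProperSpace.of_seq_closedBall (x := x) Filter.tendsto_id
    (Filter.Eventually.of_forall fun r => ?_)
  rw [← Set.image_preimage_eq (Metric.closedBall x (id r)) hs]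
  exact (Metric.isCompact_of_isClosed_isBounded
    (Metric.isClosed_closedBall.preimage hf) (hb _)).image hf

namespace GrushinPlane

theorem dist_le_iff_ccEDist_le {p q : GrushinPlane} {r : ℝ} (hr : 0 ≤ r) :
    dist p q ≤ r ↔ ccEDist p q ≤ ENNReal.ofReal r := by
  rw [← edist_eq_ccEDist, edist_le_ofReal hr]

-- Stating the velocity as `v' = u f` makes horizontality automatic and avoids the quotient `v'/u`
-- at zeros of `u`.
open MeasureTheory Set in
theorem dist_le_of_speed_le {a b M : ℝ} (hab : a ≤ b) (hM : 0 ≤ M) {u v f u' : ℝ → ℝ}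
    (hu : ContDiff ℝ ∞ u) (hv : ContDiff ℝ ∞ v) (hu' : ∀ s, HasDerivAt u (u' s) s)
    (hv' : ∀ s, HasDerivAt v (u s * f s) s) (hs : ∀ s, (f s) ^ 2 + (u' s) ^ 2 ≤ M ^ 2) :
    dist (⟨u a, v a⟩ : GrushinPlane) ⟨u b, v b⟩ ≤ M * (b - a) := by
  rw [dist_le_iff_ccEDist_le (mul_nonneg hM (sub_nonneg.2 hab))]
  let γ : HorizontalCurve ⟨u a, v a⟩ ⟨u b, v b⟩ :=
    { a := a, b := b, le := hab, u := u, v := v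
      contDiff_u := hu
      contDiff_v := hv
      horizontal := fun s _ h0 => by rw [(hv' s).deriv, h0, zero_mul]
      source := rfl
      target := rfl }
  refine (iInf_le _ γ).trans ?_
  calc γ.length ≤ ∫⁻ _ in Icc a b, ENNReal.ofReal M := by
        refine lintegral_mono fun s => ENNReal.ofReal_le_ofReal (Real.sqrt_le_iff.2 ⟨hM, ?_⟩)
        change (deriv u s) ^ 2 + (deriv v s) ^ 2 / (u s) ^ 2 ≤ _
        rw [(hu' s).deriv, (hv' s).deriv, mul_pow]
        have := div_le_of_le_mul₀ (sq_nonneg (u s)) (sq_nonneg (f s))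
          (mul_comm ((u s) ^ 2) ((f s) ^ 2)).le
        linarith [hs s]
    _ = ENNReal.ofReal (M * (b - a)) := by
        rw [setLIntegral_const, Real.volume_Icc, ENNReal.ofReal_mul hM]

/-- The projection of a horizontal segment of the Heisenberg group. -/
theorem dist_segment_le (u v α β : ℝ) :
    dist (⟨u, v⟩ : GrushinPlane) ⟨u + β, v + u * α + α * β / 2⟩ ≤ √(α ^ 2 + β ^ 2) := by
  have := dist_le_of_speed_le (a := 0) (b := 1) (M := √(α ^ 2 + β ^ 2)) zero_le_one
    (Real.sqrt_nonneg _) (u := fun s => u + s * β)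
    (v := fun s => v + s * (u * α) + s ^ 2 * (α * β / 2))
    (f := fun _ => α) (u' := fun _ => β) (by fun_prop) (by fun_prop)
    (fun s => by simpa using ((hasDerivAt_id s).mul_const β).const_add u)
    (fun s => by
      refine ((((hasDerivAt_id s).mul_const (u * α)).const_add v).add
        ((hasDerivAt_pow 2 s).mul_const (α * β / 2))).congr_deriv ?_
      simp
      ring)
    (fun s => by rw [Real.sq_sqrt (by positivity)])
  simpa using this

/-- The vertical displacement obtained by projecting a circle. -/
theorem dist_circle_le (u v R : ℝ) (hR : 0 ≤ R) :
    dist (⟨u, v⟩ : GrushinPlane) ⟨u, v + R ^ 2 * Real.pi⟩ ≤ R * (2 * Real.pi) := by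
  have := dist_le_of_speed_le (a := 0) (b := 2 * Real.pi) (M := R) Real.two_pi_pos.le hR
    (u := fun s => u + R * Real.sin s)
    (v := fun s => v + u * R * (1 - Real.cos s) + R ^ 2 / 2 * (s - Real.sin s * Real.cos s))
    (f := fun s => R * Real.sin s) (u' := fun s => R * Real.cos s)
    (by fun_prop) (by fun_prop)
    (fun s => ((Real.hasDerivAt_sin s).const_mul R).const_add u)
    (fun s => by
      refine (((((Real.hasDerivAt_cos s).const_sub 1).const_mul (u * R)).const_add v).add
        (((hasDerivAt_id s).sub
          ((Real.hasDerivAt_sin s).mul (Real.hasDerivAt_cos s))).const_mul (R ^ 2 / 2))).congr_deriv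
            ?_
      linear_combination (-R ^ 2 / 2) * Real.sin_sq_add_cos_sq s)
    (fun s => by linear_combination R ^ 2 * Real.sin_sq_add_cos_sq s)
  simp only [Real.sin_zero, Real.cos_zero, Real.sin_two_pi, Real.cos_two_pi, mul_zero, add_zero,
    zero_mul, sub_self, sub_zero] at this
  rwa [show R ^ 2 / 2 * (2 * Real.pi) = R ^ 2 * Real.pi by ring] at this

theorem dist_vertical_le (u v τ : ℝ) :
    dist (⟨u, v⟩ : GrushinPlane) ⟨u, v + τ⟩ ≤ 4 * √|τ| := by
  have key : ∀ v τ : ℝ, 0 ≤ τ → dist (⟨u, v⟩ : GrushinPlane) ⟨u, v + τ⟩ ≤ 4 * √τ := by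
    intro v τ hτ
    have hpi := Real.pi_pos
    -- The circle enclosing area `τ` has length `2√(πτ)`, at most `4√τ` because `π ≤ 4`.
    have h := dist_circle_le u v (√(τ / Real.pi)) (Real.sqrt_nonneg _)
    rw [Real.sq_sqrt (by positivity), div_mul_cancel₀ _ hpi.ne'] at h
    refine h.trans (le_of_sq_le_sq ?_ (by positivity))
    rw [mul_pow, mul_pow 4, Real.sq_sqrt (by positivity), Real.sq_sqrt hτ]
    have : τ / Real.pi * (2 * Real.pi) ^ 2 = τ * (4 * Real.pi) := by field_simp; ring
    rw [this]
    nlinarith [Real.pi_le_four]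
  rcases le_total 0 τ with hτ | hτ
  · rw [abs_of_nonneg hτ]
    exact key v τ hτ
  · rw [abs_of_nonpos hτ, dist_comm]
    simpa using key (v + τ) (-τ) (neg_nonneg.2 hτ)

open MeasureTheory Set in
/-- The box part of the ball–box estimate for the Grushin plane. -/
theorem exists_shift_of_dist_lt {p w : GrushinPlane} {r : ℝ} (hpw : dist p w < r) :
    ∃ δ : ℝ, |δ| ≤ r ∧ |w.u - p.u| ≤ r ∧ |w.v - p.v - p.u * δ| ≤ r ^ 2 := by
  have hr : 0 < r := dist_nonneg.trans_lt hpw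
  have hlt : ccEDist p w < ENNReal.ofReal r := by
    rw [← edist_eq_ccEDist, edist_dist]
    exact (ENNReal.ofReal_lt_ofReal_iff hr).2 hpw
  obtain ⟨γ, hγ⟩ := iInf_lt_iff.1 hlt
  obtain ⟨h, hh, hint, hlen⟩ := γ.exists_contDiff_lift hγ
  have hua : γ.u γ.a = p.u := congrArg GrushinPlane.u γ.source
  have hub : γ.u γ.b = w.u := congrArg GrushinPlane.u γ.target
  have hu : ∀ s ∈ Icc γ.a γ.b, |γ.u s - p.u| ≤ r := by
    intro s hs
    have := (γ.enorm_u_sub_le hs).trans hγ.le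
    rw [hua, Real.enorm_eq_ofReal_abs] at this
    exact (ENNReal.ofReal_le_ofReal_iff hr.le).1 this
  have hhi : IntegrableOn h (Icc γ.a γ.b) :=
    hh.continuous.continuousOn.integrableOn_compact isCompact_Icc
  have habs : ∫ s in Icc γ.a γ.b, |h s| ≤ r := by
    rw [← ENNReal.ofReal_le_ofReal_iff hr.le, ofReal_integral_eq_lintegral_ofReal hhi.abs
      (Filter.Eventually.of_forall fun s => abs_nonneg _)]
    exact (lintegral_mono fun s => ENNReal.ofReal_le_ofReal (Real.abs_le_sqrt
      (le_add_of_nonneg_right (sq_nonneg _)))).trans hlen.le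
  -- `δ` is the displacement of the approximate lift along the line. The remaining error is `∫ (u -
  -- p.u) h`, with `|u - p.u| ≤ r` on the curve and `∫ |h| ≤ r`.
  refine ⟨∫ s in Icc γ.a γ.b, h s, abs_integral_le_integral_abs.trans habs, ?_, ?_⟩
  · rw [← hub]
    exact hu _ (right_mem_Icc.2 γ.le)
  · have hci : ∀ {f : ℝ → ℝ}, Continuous f → IntegrableOn f (Icc γ.a γ.b) := fun hf =>
      hf.continuousOn.integrableOn_compact isCompact_Icc
    have cu := γ.contDiff_u.continuous
    have ch := hh.continuous
    have e : (∫ s in Icc γ.a γ.b, (γ.u s * h s - p.u * h s))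
        = (∫ s in Icc γ.a γ.b, γ.u s * h s) - ∫ s in Icc γ.a γ.b, p.u * h s :=
      integral_sub (hci (cu.mul ch)) (hhi.const_mul _)
    rw [← hint, intervalIntegral.integral_of_le γ.le, ← integral_Icc_eq_integral_Ioc,
      ← integral_const_mul, ← e]
    calc |∫ s in Icc γ.a γ.b, (γ.u s * h s - p.u * h s)|
        ≤ ∫ s in Icc γ.a γ.b, |γ.u s * h s - p.u * h s| := abs_integral_le_integral_abs
      _ ≤ ∫ s in Icc γ.a γ.b, r * |h s| := by
          refine setIntegral_mono_on (hci (by fun_prop)) (hci (by fun_prop)) measurableSet_Icc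
            fun s hs => ?_
          rw [← sub_mul, abs_mul]
          exact mul_le_mul_of_nonneg_right (hu s hs) (abs_nonneg _)
      _ = r * ∫ s in Icc γ.a γ.b, |h s| := integral_const_mul _ _
      _ ≤ r ^ 2 := by rw [pow_two]; exact mul_le_mul_of_nonneg_left habs hr.le

theorem continuous_mk : Continuous fun z : ℝ × ℝ => (⟨z.1, z.2⟩ : GrushinPlane) := by
  refine continuous_iff_continuousAt.2 fun z => tendsto_iff_dist_tendsto_zero.2 ?_
  have hc : Continuous fun z' : ℝ × ℝ => √((0 : ℝ) ^ 2 + (z.1 - z'.1) ^ 2) + 4 * √|z.2 - z'.2| := by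
    fun_prop
  have hz := hc.tendsto z
  simp only [sub_self, abs_zero, Real.sqrt_zero, mul_zero, add_zero, ne_eq, OfNat.ofNat_ne_zero,
    not_false_eq_true, zero_pow] at hz
  refine squeeze_zero (fun _ => dist_nonneg) (fun z' => ?_) hz
  refine (dist_triangle _ (⟨z.1, z'.2⟩ : GrushinPlane) _).trans (add_le_add ?_ ?_)
  · simpa using dist_segment_le z'.1 z'.2 0 (z.1 - z'.1)
  · simpa using dist_vertical_le z.1 z'.2 (z.2 - z'.2)

/-- Around the origin `p.u = 0`, so the shift `δ` drops out of the box estimate and balls lie in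
Euclidean boxes. -/
instance : ProperSpace GrushinPlane := by
  refine properSpace_of_continuous_surjective continuous_mk (fun w => ⟨(w.u, w.v), rfl⟩) ⟨0, 0⟩
    fun r => ?_
  refine (Metric.isBounded_Icc (-(r + 1)) (r + 1) |>.prod
    (Metric.isBounded_Icc (-(r + 1) ^ 2) ((r + 1) ^ 2))).subset fun z hz => ?_
  obtain ⟨δ, -, h1, h2⟩ := exists_shift_of_dist_lt (r := r + 1)
    (show dist (⟨0, 0⟩ : GrushinPlane) ⟨z.1, z.2⟩ < r + 1 by
      rw [dist_comm]
      exact lt_of_le_of_lt hz (lt_add_one r))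
  simp only [sub_zero, zero_mul] at h1 h2
  exact ⟨abs_le.1 h1, abs_le.1 h2⟩

end GrushinPlane

/-! ### Properness of the Heisenberg group, Lipschitz bound and covering -/

namespace Heis

theorem sqrt_sq_add_sq_le_koranyiNorm (p : Heis) : √(p.x1 ^ 2 + p.x2 ^ 2) ≤ p.koranyiNorm := by
  refine Real.sqrt_le_iff.2 ⟨koranyiNorm_nonneg p, ?_⟩
  rw [koranyiNorm_sq]
  exact (le_abs_self _).trans (Complex.abs_re_le_norm ⟨p.x1 ^ 2 + p.x2 ^ 2, p.t⟩)

theorem sqrt_abs_le_koranyiNorm (p : Heis) : √|p.t| ≤ p.koranyiNorm := by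
  refine Real.sqrt_le_iff.2 ⟨koranyiNorm_nonneg p, ?_⟩
  rw [koranyiNorm_sq]
  exact Complex.abs_im_le_norm ⟨p.x1 ^ 2 + p.x2 ^ 2, p.t⟩

theorem continuous_koranyiNorm_mk :
    Continuous fun z : ℝ × ℝ × ℝ => (⟨z.1, z.2.1, z.2.2⟩ : Heis).koranyiNorm := by
  unfold koranyiNorm
  exact Continuous.rpow_const (by fun_prop) fun _ => Or.inr (by norm_num)

theorem continuous_mk : Continuous fun z : ℝ × ℝ × ℝ => (⟨z.1, z.2.1, z.2.2⟩ : Heis) := by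
  refine continuous_iff_continuousAt.2 fun z => tendsto_iff_dist_tendsto_zero.2 ?_
  have hc : Continuous fun z' : ℝ × ℝ × ℝ => ((-z'.1 + z.1, -z'.2.1 + z.2.1,
      -z'.2.2 + z.2.2 + 2 * (-z'.2.1 * z.1 - -z'.1 * z.2.1)) : ℝ × ℝ × ℝ) := by fun_prop
  have := (continuous_koranyiNorm_mk.comp hc).tendsto z
  rw [← dist_self (⟨z.1, z.2.1, z.2.2⟩ : Heis)]
  exact this

instance : ProperSpace Heis := by
  refine properSpace_of_continuous_surjective continuous_mk
    (fun p => ⟨(p.x1, p.x2, p.t), rfl⟩) 1 fun r => ?_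
  refine (Metric.isBounded_Icc (-r) r |>.prod ((Metric.isBounded_Icc (-r) r).prod
    (Metric.isBounded_Icc (-r ^ 2) (r ^ 2)))).subset fun z hz => ?_
  set p : Heis := ⟨z.1, z.2.1, z.2.2⟩
  have hpr : p.koranyiNorm ≤ r := by
    have h : dist p 1 ≤ r := hz
    rw [dist_comm] at h
    change ((1 : Heis)⁻¹ * p).koranyiNorm ≤ r at h
    simpa using h
  have h1 := (sqrt_sq_add_sq_le_koranyiNorm p).trans hpr
  have h2 := (sqrt_abs_le_koranyiNorm p).trans hpr
  refine ⟨abs_le.1 ((Real.abs_le_sqrt ?_).trans h1), abs_le.1 ((Real.abs_le_sqrt ?_).trans h1),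
    abs_le.1 (Real.sqrt_le_iff.1 h2).2⟩
  · exact le_add_of_nonneg_right (sq_nonneg _)
  · exact le_add_of_nonneg_left (sq_nonneg _)

variable {a b : ℝ}

/-- Without the term `g.t / 4` this is the endpoint in `dist_segment_le`; that term is a vertical
shift. -/
theorem toGrushin_mul (h : a ^ 2 + b ^ 2 = 1) (p g : Heis) :
    toGrushin a b (p * g) = ⟨(toGrushin a b p).u + across a b g,
      (toGrushin a b p).v + (toGrushin a b p).u * along a b g + along a b g * across a b g / 2
        + g.t / 4⟩ := by
  ext <;> simp only [toGrushin, along, across, mul_x1, mul_x2, mul_t]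
  · ring
  · linear_combination ((p.x1 * g.x2 - p.x2 * g.x1) / 2) * h

/-- The segment contributes `1` to the constant, and the vertical shift contributes `2`, from `4 √|t
/ 4| = 2 √|t|`. -/
theorem lipschitzWith_toGrushin (h : a ^ 2 + b ^ 2 = 1) : LipschitzWith 3 (toGrushin a b) := by
  refine LipschitzWith.of_dist_le_mul fun p q => ?_
  obtain ⟨g, rfl⟩ : ∃ g, q = p * g := ⟨p⁻¹ * q, by group⟩
  have hd : dist p (p * g) = g.koranyiNorm := by
    change (p⁻¹ * (p * g)).koranyiNorm = _
    rw [inv_mul_cancel_left]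
  rw [hd, toGrushin_mul h]
  have h1 := GrushinPlane.dist_segment_le (toGrushin a b p).u (toGrushin a b p).v
    (along a b g) (across a b g)
  have h2 := GrushinPlane.dist_vertical_le ((toGrushin a b p).u + across a b g)
    ((toGrushin a b p).v + (toGrushin a b p).u * along a b g + along a b g * across a b g / 2)
    (g.t / 4)
  have e1 : along a b g ^ 2 + across a b g ^ 2 = g.x1 ^ 2 + g.x2 ^ 2 := by
    simp only [along, across]
    linear_combination (g.x1 ^ 2 + g.x2 ^ 2) * h
  have e2 : 4 * √|g.t / 4| = 2 * √|g.t| := by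
    rw [abs_div, Real.sqrt_div (abs_nonneg _), show |(4 : ℝ)| = 2 ^ 2 by norm_num,
      Real.sqrt_sq zero_le_two]
    ring
  rw [e1] at h1
  rw [e2] at h2
  have h3 := dist_triangle _ _ _ |>.trans (add_le_add h1 h2)
  refine h3.trans ?_
  have := sqrt_sq_add_sq_le_koranyiNorm g
  have := sqrt_abs_le_koranyiNorm g
  push_cast
  linarith

theorem koranyiNorm_lt {p : Heis} {A B c : ℝ} (h1 : p.x1 ^ 2 + p.x2 ^ 2 ≤ A ^ 2)
    (hA : 0 ≤ A) (h2 : |p.t| ≤ B ^ 2) (hB : 0 ≤ B) (hc : A + B < c) : p.koranyiNorm < c := by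
  refine lt_of_le_of_lt (le_of_sq_le_sq ?_ (add_nonneg hA hB)) hc
  rw [koranyiNorm_sq]
  refine (Complex.norm_le_abs_re_add_abs_im _).trans ?_
  dsimp only
  rw [abs_of_nonneg (by positivity)]
  nlinarith [mul_nonneg hA hB]

/-- A point lying over a point near `w` is close to the point of the fibre over `w` with a suitable
coordinate along the fibre; an error `e` in this coordinate costs `√|e|`. -/
theorem dist_ofGrushin_lt (h : a ^ 2 + b ^ 2 = 1) {p : Heis} {w : GrushinPlane} {δ z r M : ℝ}
    (hM : 0 ≤ M) (hr : 0 < r) (hr1 : r < 1) (hp : |across a b p| ≤ M) (hδ : |δ| ≤ r)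
    (hu : |w.u - (toGrushin a b p).u| ≤ r)
    (hv : |w.v - (toGrushin a b p).v - (toGrushin a b p).u * δ| ≤ r ^ 2)
    (hz : |z - (along a b p + δ)| ≤ r ^ 2) :
    dist p (ofGrushin a b z w.u w.v) < (12 + 4 * M) * r := by
  set q := ofGrushin a b z w.u w.v with hq
  set e := z - (along a b p + δ) with he
  set u := across a b p with hu_def
  have hu' : (toGrushin a b p).u = u := rfl
  rw [hu'] at hu hv
  have hz' : z = along a b p + δ + e := by rw [he]; ring
  have er : |e| ≤ r := hz.trans (by nlinarith)
  have e1 : (p⁻¹ * q).x1 ^ 2 + (p⁻¹ * q).x2 ^ 2 = (δ + e) ^ 2 + (w.u - u) ^ 2 := by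
    have hx1 : p.x1 = a * along a b p - b * u := by
      simp only [along, hu_def, across]; linear_combination (-p.x1) * h
    have hx2 : p.x2 = b * along a b p + a * u := by
      simp only [along, hu_def, across]; linear_combination (-p.x2) * h
    simp only [mul_x1, mul_x2, inv_x1, inv_x2, hq, ofGrushin, hx1, hx2, hz']
    linear_combination ((δ + e) ^ 2 + (w.u - u) ^ 2) * h
  have e2 : (p⁻¹ * q).t = 4 * (w.v - (toGrushin a b p).v - u * δ) - 2 * ((w.u - u) * δ)
      - 2 * ((w.u - u) * e) - 4 * (u * e) := by
    simp only [mul_t, inv_x1, inv_x2, inv_t, hq, ofGrushin, toGrushin, hz', along, across, hu_def]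
    ring
  have b1 : |(w.u - u) * δ| ≤ r ^ 2 := by
    rw [abs_mul, pow_two]; exact mul_le_mul hu hδ (abs_nonneg _) hr.le
  have b2 : |(w.u - u) * e| ≤ r ^ 2 := by
    rw [abs_mul, pow_two]; exact mul_le_mul hu er (abs_nonneg _) hr.le
  have b3 : |u * e| ≤ M * r ^ 2 := by
    rw [abs_mul]; exact mul_le_mul hp hz (abs_nonneg _) hM
  -- The horizontal part squared is at most `4r² + r² ≤ (3r)²`, and the vertical part is at most `(8
  -- + 4M) r² ≤ (3 + 4M)² r²`.
  refine koranyiNorm_lt (A := 3 * r) (B := (3 + 4 * M) * r) ?_ (by positivity) ?_ (by positivity)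
    (by nlinarith)
  · rw [e1]
    have h1 : (δ + e) ^ 2 ≤ (2 * r) ^ 2 := sq_le_sq.2 (by
      rw [abs_of_nonneg (by positivity : 0 ≤ 2 * r)]; linarith [abs_add_le δ e])
    have h2 : (w.u - u) ^ 2 ≤ r ^ 2 := sq_le_sq.2 (by rwa [abs_of_nonneg hr.le])
    nlinarith
  · rw [e2]
    have : |4 * (w.v - (toGrushin a b p).v - u * δ) - 2 * ((w.u - u) * δ)
        - 2 * ((w.u - u) * e) - 4 * (u * e)| ≤ (8 + 4 * M) * r ^ 2 := by
      rw [abs_le] at *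
      constructor <;> linarith
    refine this.trans ?_
    rw [mul_pow]
    exact mul_le_mul_of_nonneg_right (by nlinarith) (sq_nonneg r)

/-- The part of a compact set lying over a ball of radius `r` is covered by `≲ r ^ (-2)` balls of
radius comparable to `r`. -/
theorem exists_covering_toGrushin (h : a ^ 2 + b ^ 2 = 1) {K : Set Heis} (hK : IsCompact K) :
    ∃ C : ℝ, 1 ≤ C ∧ ∀ (w : GrushinPlane) (r : ℝ), 0 < r → r < 1 →
      ∃ T : Finset Heis, (T.card : ℝ) ≤ C * r ^ (-2 : ℝ) ∧
        toGrushin a b ⁻¹' Metric.ball w r ∩ K ⊆ ⋃ x ∈ T, Metric.ball x (C * r) := by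
  obtain ⟨M, hM⟩ := hK.isBounded.subset_closedBall 1
  have hKM : ∀ p ∈ K, |along a b p| ≤ max M 0 ∧ |across a b p| ≤ max M 0 := by
    intro p hp
    have hpM : p.koranyiNorm ≤ M := by
      have hd : dist p 1 ≤ M := hM hp
      rw [dist_comm] at hd
      change ((1 : Heis)⁻¹ * p).koranyiNorm ≤ M at hd
      simpa using hd
    have e1 : along a b p ^ 2 + across a b p ^ 2 = p.x1 ^ 2 + p.x2 ^ 2 := by
      simp only [along, across]
      linear_combination (p.x1 ^ 2 + p.x2 ^ 2) * h
    have hle := ((sqrt_sq_add_sq_le_koranyiNorm p).trans hpM).trans (le_max_left M 0)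
    rw [← e1] at hle
    exact ⟨(Real.abs_le_sqrt (le_add_of_nonneg_right (sq_nonneg _))).trans hle,
      (Real.abs_le_sqrt (le_add_of_nonneg_left (sq_nonneg _))).trans hle⟩
  have hM0 : 0 ≤ max M 0 := le_max_right _ _
  generalize max M 0 = N at hKM hM0
  refine ⟨12 + 4 * N, by linarith, fun w r hr hr1 => ?_⟩
  have hr2 : 0 < r ^ 2 := by positivity
  have hr21 : r ^ 2 ≤ 1 := by nlinarith
  classical
  -- The targets `along a b p + δ` lie in `[-(N + 1), N + 1]`, to be rounded down to multiples of
  -- `r²`; the extra `1` leaves room for the rounding at the lower end.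
  set n : ℕ := ⌈(N + 1) / r ^ 2⌉₊ + 1 with hn
  refine ⟨(Finset.Icc (-(n : ℤ)) n).image
    fun k : ℤ => ofGrushin a b (k * r ^ 2) w.u w.v, ?_, ?_⟩
  · have hcard : (((Finset.Icc (-(n : ℤ)) n).card : ℕ) : ℝ) = 2 * n + 1 := by
      rw [Int.card_Icc]
      have : ((n : ℤ) + 1 - -(n : ℤ)).toNat = 2 * n + 1 := by omega
      rw [this]
      push_cast
      ring
    have hnle : (n : ℝ) ≤ (N + 1) / r ^ 2 + 2 := by
      have := (Nat.ceil_lt_add_one (show 0 ≤ (N + 1) / r ^ 2 by positivity)).le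
      rw [hn]
      push_cast
      linarith
    have hinv : 1 ≤ (r ^ 2)⁻¹ := (one_le_inv₀ hr2).2 hr21
    calc _ ≤ (((Finset.Icc (-(n : ℤ)) n).card : ℕ) : ℝ) := by
          exact_mod_cast Finset.card_image_le
      _ = 2 * n + 1 := hcard
      _ ≤ (12 + 4 * N) * (r ^ 2)⁻¹ := by
          rw [div_eq_mul_inv] at hnle
          nlinarith
      _ = _ := by rw [Real.rpow_neg hr.le, Real.rpow_two]
  · rintro p ⟨hpw, hp⟩
    obtain ⟨δ, h1, h2, h3⟩ := GrushinPlane.exists_shift_of_dist_lt hpw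
    obtain ⟨hy, hu⟩ := hKM p hp
    set k : ℤ := ⌊(along a b p + δ) / r ^ 2⌋
    have hk1 : (k : ℝ) * r ^ 2 ≤ along a b p + δ := by
      rw [← le_div_iff₀ hr2]; exact Int.floor_le _
    have hk2 : along a b p + δ < (k + 1) * r ^ 2 := by
      rw [← div_lt_iff₀ hr2]; exact Int.lt_floor_add_one _
    have habs : |along a b p + δ| ≤ N + 1 := by linarith [abs_add_le (along a b p) δ]
    have hNn : N + 1 ≤ (n - 1 : ℝ) * r ^ 2 := by
      rw [← div_le_iff₀ hr2, hn]
      push_cast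
      simpa using Nat.le_ceil ((N + 1) / r ^ 2)
    rw [abs_le] at habs
    refine Set.mem_iUnion₂.2 ⟨_, Finset.mem_image_of_mem _ (Finset.mem_Icc.2 ⟨?_, ?_⟩ : k ∈ _), ?_⟩
    · have : (-(n : ℝ)) ≤ k := by
        have : (-(n : ℝ)) * r ^ 2 < (k : ℝ) * r ^ 2 := by nlinarith
        exact (lt_of_mul_lt_mul_right this hr2.le).le
      exact_mod_cast this
    · have : (k : ℝ) ≤ n := by
        have : (k : ℝ) * r ^ 2 < n * r ^ 2 := by nlinarith
        exact (lt_of_mul_lt_mul_right this hr2.le).le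
      exact_mod_cast this
    · refine dist_ofGrushin_lt h hM0 hr hr1 hu h1 h2 h3 ?_
      rw [abs_le]
      constructor <;> linarith

end Heis

/-! ### Conclusion for an arbitrary identification -/

theorem mainTheorem6 (V : Subgroup Heis) (hV : Heis.IsHorizontalLine V) :
    (∃ Φ : Heis.RightCosets V ≃ GrushinPlane, IsGrushinIdentification V Φ) ∧
    ∀ Φ : Heis.RightCosets V ≃ GrushinPlane, IsGrushinIdentification V Φ →
      IsMetricFoliation 2 (rightCosetProjection V Φ) ∧
      ∃ L : NNReal, LipschitzWith L (rightCosetProjection V Φ) := by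
  obtain ⟨a, b, h, hVab⟩ := hV.exists_unit
  have hΨ := Heis.isGrushinIdentification_cosetEquiv h hVab
  set Ψ := Heis.cosetEquiv h hVab
  refine ⟨⟨Ψ, hΨ⟩, fun Φ hΦ => ?_⟩
  have hdist : ∀ A B, dist (Φ A) (Φ B) = dist (Ψ A) (Ψ B) := fun A B => by
    rw [dist_edist, dist_edist, hΦ, hΨ]
  have hLip : LipschitzWith 3 (rightCosetProjection V Φ) :=
    LipschitzWith.of_dist_le_mul fun p q =>
      (hdist _ _).trans_le ((Heis.lipschitzWith_toGrushin h).dist_le_mul p q)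
  refine ⟨⟨zero_le_two, inferInstance, inferInstance, ?_, fun K _ => ⟨3, hLip.lipschitzOnWith⟩,
    fun K hK => ?_⟩, 3, hLip⟩
  · exact Φ.surjective.comp Quotient.mk_surjective
  · obtain ⟨C, hC, hcov⟩ := Heis.exists_covering_toGrushin h hK
    refine ⟨C, hC, 1, one_pos, fun w r hr hr1 => ?_⟩
    -- `Ψ ∘ Φ⁻¹` is an isometry of the Grushin plane, so the preimage of the ball about `w` under
    -- one projection is that of the ball about its image under the other.
    obtain ⟨T, hT, hsub⟩ := hcov (Ψ (Φ.symm w)) r hr hr1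
    refine ⟨T, hT, fun p ⟨hpw, hp⟩ => hsub ⟨?_, hp⟩⟩
    have := hdist (Heis.toRightCoset V p) (Φ.symm w)
    rw [Φ.apply_symm_apply] at this
    exact this.symm.trans_lt hpw
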